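/- Let $n\ge 4$ and let $\Delta$ be a (reduced, crystallographic) root system of type $D_n$, with a fixed set of positive roots $\Delta^+\subset\Delta$ and Weyl group $W$. For $w\in W$ put $$N(w)=\{\alpha\in\Delta^+ \mid w^{-1}(\alpha)\in-\Delta^+\}.$$ A subset $Y\subset W$ is called inversion complete if $\bigcup_{w\in Y}N(w)=\Delta^+$, and minimal inversion complete if it is inversion complete and no proper subset of $Y$ is inversion complete. Then the maximal cardinality of a minimal inversion complete subset of $W$ is $\binom{n}{2}$; that is, every minimal inversion complete subset of $W$ has at most $\binom n2$ elements, and some minimal inversion complete subset has exactly $\binom n2$ elements. -/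

import Mathlib

/-!
Inversion sets in Weyl groups and minimal inversion complete sets.

Throughout, `P` is a root pairing with root space `M`, and `b` is a base (a set of simple roots)
of `P`; the fixed set of positive roots is the one determined by `b`.
-/

namespace RootPairing.Base

variable {ι R M N : Type*} [CommRing R] [CharZero R] [AddCommGroup M] [Module R M]
  [AddCommGroup N] [Module R N] {P : RootPairing ι R M N}

/-- The set `Δ⁺ ⊆ M` of positive roots determined by the base `b`. -/
def positiveRoots (b : P.Base) : Set M :=
  {α | ∃ i, b.IsPos i ∧ P.root i = α}

/-- The (generalized) inversion set `N(w) = {α ∈ Δ⁺ | w⁻¹(α) ∈ -Δ⁺}` of an element `w` of the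
Weyl group. -/
def inversionSet (b : P.Base) (w : P.weylGroup) : Set M :=
  {α | α ∈ b.positiveRoots ∧ -(w⁻¹ • α) ∈ b.positiveRoots}

/-- A set `Y` of elements of the Weyl group is inversion complete if the inversion sets `N(w)`,
`w ∈ Y`, cover the set of positive roots. -/
def IsInversionComplete (b : P.Base) (Y : Set P.weylGroup) : Prop :=
  ⋃ w ∈ Y, b.inversionSet w = b.positiveRoots

/-- A set `Y` of elements of the Weyl group is minimal inversion complete if it is inversion
complete and minimal, with respect to inclusion, among the inversion complete sets. -/
def IsMinimalInversionComplete (b : P.Base) (Y : Set P.weylGroup) : Prop :=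
  Minimal b.IsInversionComplete Y

/-- The simple roots in `b` form a system of simple roots of type `Dₙ`: they can be numbered by
`Fin n` in such a way that the Cartan matrix becomes the Cartan matrix of type `Dₙ`. -/
def IsTypeD [P.IsCrystallographic] (b : P.Base) (n : ℕ) : Prop :=
  ∃ e : b.support ≃ Fin n, ∀ i j, b.cartanMatrix i j = CartanMatrix.D n (e i) (e j)

end RootPairing.Base

/-! In coordinates the positive roots are `v i ± v j` with `i < j`. Upper bound: by minimality each
`w ∈ Y` inverts a private root, inverted by no other element of `Y`. A positive root `x` is inverted
by some `w ∈ Y`, so a positive form composed with `w⁻¹` is negative on `x` and positive on all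
private roots but that of `w` (`IsSeparated`). Hence no private root is the sum of two others, and
no positive root is a sum of private roots in two disjoint ways. For four indices a finite check
gives at most 6; averaging over index subsets gives `n.choose 2` (`IsSeparated.card_le`). Lower
bound: the elements inverting at most one `v i + v j` are already inversion complete. A minimal
inversion complete set among them needs a different element for each of the `n.choose 2` sums. -/

lemma exists_perm_apply_eq_and_apply_eq {κ : Type*} [DecidableEq κ] {i j k l : κ} (hij : i ≠ j)
    (hkl : k ≠ l) : ∃ σ : Equiv.Perm κ, σ i = k ∧ σ j = l := by
  have h1 : Equiv.swap i k j ≠ k := by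
    intro h
    exact hij ((Equiv.swap i k).injective (h.trans (Equiv.swap_apply_left i k).symm)).symm
  exact ⟨Equiv.swap (Equiv.swap i k j) l * Equiv.swap i k,
    by simp [Equiv.swap_apply_of_ne_of_ne h1.symm hkl], by simp⟩

/-! ### Combinatorics of separated sets of roots -/

set_option synthInstance.maxSize 2000 in
set_option synthInstance.maxHeartbeats 400000 in
set_option maxRecDepth 100000 in
/-- If every sum in the positive system of type `D₄` has at most one expression as an element of
a set or as a sum of two of its elements, then the set has at most six elements. -/
lemma card_le_six_of_unique_sums :
    ∀ mab mbc mac : Bool, !(mac && mab && mbc) → ∀ mcd mbd : Bool, !(mbd && mbc && mcd) →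
    ∀ mad : Bool, !(mad && mab && mbd) → !(mad && mac && mcd) →
      !(mab && mbd && mac && mcd) →
    ∀ pcd pbd : Bool, !(pbd && mbc && pcd) →
    ∀ pbc : Bool, !(pbc && mbd && pcd) → !(pbc && pbd && mcd) →
      !(mbd && pcd && pbd && mcd) →
    ∀ pad : Bool, !(pad && mab && pbd) → !(pad && mac && pcd) →
      !(mab && pbd && mac && pcd) →
    ∀ pac : Bool, !(pac && mab && pbc) → !(pac && mad && pcd) → !(pac && pad && mcd) →
      !(mab && pbc && mad && pcd) → !(mab && pbc && pad && mcd) →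
      !(mad && pcd && pad && mcd) →
    ∀ pab : Bool, !(pab && mac && pbc) → !(pab && pac && mbc) → !(pab && mad && pbd) →
      !(pab && pad && mbd) → !(mac && pbc && pac && mbc) → !(mac && pbc && mad && pbd) →
      !(mac && pbc && pad && mbd) → !(pac && mbc && mad && pbd) → !(pac && mbc && pad && mbd) →
      !(mad && pbd && pad && mbd) →
    mab.toNat + mac.toNat + mad.toNat + mbc.toNat + mbd.toNat + mcd.toNat +
      pab.toNat + pac.toNat + pad.toNat + pbc.toNat + pbd.toNat + pcd.toNat ≤ 6 := by
  -- `mij` and `pij` record membership of the difference and the sum root. Each constraint stands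
  -- right after its last variable is bound, so the case search is pruned early.
  decide

/-- The vector `v i + v j` or `v i - v j` attached to `(i, j, true)` or `(i, j, false)`. -/
def signedSum {κ V : Type*} [AddCommGroup V] (v : κ → V) (x : κ × κ × Bool) : V :=
  if x.2.2 then v x.1 + v x.2.1 else v x.1 - v x.2.1

lemma smul_signedSum {G κ V : Type*} [AddCommGroup V] [Monoid G] [DistribMulAction G V] (g : G)
    (v : κ → V) (x : κ × κ × Bool) : g • signedSum v x = signedSum (fun k ↦ g • v k) x := by
  simp only [signedSum]
  split_ifs <;> simp [smul_sub]

lemma map_signedSum {κ V : Type*} [AddCommGroup V] [Module ℝ V] (f : V →ₗ[ℝ] ℝ)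
    (v : κ → V) (x : κ × κ × Bool) : f (signedSum v x) = signedSum (fun k ↦ f (v k)) x := by
  simp only [signedSum]
  split_ifs <;> simp

/-- A set of positive roots of type `Dₙ` (encoded as in `signedSum`) is separated if for each
positive root `x` some linear form is negative on `x` and positive on all but at most one element
of the set. -/
def IsSeparated {n : ℕ} (A : Finset (Fin n × Fin n × Bool)) : Prop :=
  ∀ x : Fin n × Fin n × Bool, x.1 < x.2.1 → ∃ (l : Fin n → ℝ) (a : Fin n × Fin n × Bool),
    signedSum l x < 0 ∧ ∀ y ∈ A, y ≠ a → 0 < signedSum l y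

namespace IsSeparated

variable {n : ℕ} {A : Finset (Fin n × Fin n × Bool)}

lemma not_mem_of_sum (hA : IsSeparated A) {x y z : Fin n × Fin n × Bool} (hx : x.1 < x.2.1)
    (h : ∀ l : Fin n → ℝ, signedSum l x = signedSum l y + signedSum l z)
    (hxy : x ≠ y) (hxz : x ≠ z) : ¬ (x ∈ A ∧ y ∈ A ∧ z ∈ A) := by
  rintro ⟨hxA, hyA, hzA⟩
  obtain ⟨l, a, h1, h2⟩ := hA x hx
  obtain rfl : x = a := by
    by_contra hne
    exact (h2 x hxA hne).not_gt h1
  linarith [h l, h2 y hyA hxy.symm, h2 z hzA hxz.symm]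

/-- The form negative on `x` must be nonpositive on a member of each pair, but only one exception is
allowed. Here `x` itself need not lie in `A`. -/
lemma not_mem_of_sum_eq_sum (hA : IsSeparated A) {x y z y' z' : Fin n × Fin n × Bool}
    (hx : x.1 < x.2.1)
    (h : ∀ l : Fin n → ℝ, signedSum l x = signedSum l y + signedSum l z)
    (h' : ∀ l : Fin n → ℝ, signedSum l x = signedSum l y' + signedSum l z')
    (hne : y ≠ y' ∧ y ≠ z' ∧ z ≠ y' ∧ z ≠ z') :
    ¬ (y ∈ A ∧ z ∈ A ∧ y' ∈ A ∧ z' ∈ A) := by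
  rintro ⟨hy, hz, hy', hz'⟩
  obtain ⟨l, a, h1, h2⟩ := hA x hx
  by_cases hm : y = a ∨ z = a
  · have := h2 y' hy' (by rintro rfl; rcases hm with h | h <;> simp_all)
    have := h2 z' hz' (by rintro rfl; rcases hm with h | h <;> simp_all)
    linarith [h' l]
  · push Not at hm
    linarith [h l, h2 y hy hm.1, h2 z hz hm.2]

lemma card_filter_four_le (hA : IsSeparated A) (hlt : ∀ x ∈ A, x.1 < x.2.1)
    {a b c d : Fin n} (hab : a < b) (hbc : b < c) (hcd : c < d) :
    (A.filter fun x ↦ x.1 ∈ ({a, b, c, d} : Finset (Fin n)) ∧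
      x.2.1 ∈ ({a, b, c, d} : Finset (Fin n))).card ≤ 6 := by
  have hac := hab.trans hbc
  have hbd := hbc.trans hcd
  have had := hac.trans hcd
  have nab := hab.ne
  have nac := hac.ne
  have nad := had.ne
  have nbc := hbc.ne
  have nbd := hbd.ne
  have ncd := hcd.ne
  let L : List (Fin n × Fin n × Bool) := [(a, b, false), (a, c, false), (a, d, false),
    (b, c, false), (b, d, false), (c, d, false), (a, b, true), (a, c, true), (a, d, true),
    (b, c, true), (b, d, true), (c, d, true)]
  have hsub : (A.filter fun x ↦ x.1 ∈ ({a, b, c, d} : Finset (Fin n)) ∧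
      x.2.1 ∈ ({a, b, c, d} : Finset (Fin n))) ⊆ (L.filter (· ∈ A)).toFinset := by
    rintro ⟨i, j, s⟩ hx
    obtain ⟨hxA, hi, hj⟩ := Finset.mem_filter.1 hx
    have hij := hlt _ hxA
    simp only [Finset.mem_insert, Finset.mem_singleton] at hi hj hij
    rw [List.mem_toFinset, List.mem_filter]
    refine ⟨?_, by simpa using hxA⟩
    rcases hi with rfl | rfl | rfl | rfl <;> rcases hj with rfl | rfl | rfl | rfl <;>
      first
      | exact (lt_irrefl _ hij).elim
      | exact (lt_asymm hij (by assumption)).elim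
      | cases s <;> simp [L]
  refine (Finset.card_le_card hsub).trans ((List.toFinset_card_le _).trans ?_)
  have key : (L.filter (· ∈ A)).length = (L.map fun x ↦ (decide (x ∈ A)).toNat).sum := by
    generalize L = L
    induction L with
    | nil => rfl
    | cons x L ih => by_cases hx : x ∈ A <;> simp [hx, ih, add_comm]
  rw [key]
  simp only [L, List.map_cons, List.map_nil, List.sum_cons, List.sum_nil, add_zero, ← add_assoc]
  apply card_le_six_of_unique_sums
  all_goals
    simp only [Bool.not_eq_true', ← Bool.not_eq_true, Bool.and_eq_true, decide_eq_true_eq, and_assoc]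
  all_goals
    first
    -- Three-term constraints come from a root that is a sum of two others. The remaining
    -- alternatives run through the roots `x` with two disjoint decompositions.
    | refine hA.not_mem_of_sum (by assumption) (fun l ↦ ?_) ?_ ?_
      · simp only [signedSum, reduceIte, Bool.false_eq_true]; ring1
      · simp [*, Ne.symm]
      · simp [*, Ne.symm]
    | refine hA.not_mem_of_sum_eq_sum (x := (a, b, true)) (by assumption) (fun l ↦ ?_) (fun l ↦ ?_) ?_
      · simp only [signedSum, reduceIte, Bool.false_eq_true]; ring1
      · simp only [signedSum, reduceIte, Bool.false_eq_true]; ring1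
      · simp [*, Ne.symm]
    | refine hA.not_mem_of_sum_eq_sum (x := (a, c, true)) (by assumption) (fun l ↦ ?_) (fun l ↦ ?_) ?_
      · simp only [signedSum, reduceIte, Bool.false_eq_true]; ring1
      · simp only [signedSum, reduceIte, Bool.false_eq_true]; ring1
      · simp [*, Ne.symm]
    | refine hA.not_mem_of_sum_eq_sum (x := (b, c, true)) (by assumption) (fun l ↦ ?_) (fun l ↦ ?_) ?_
      · simp only [signedSum, reduceIte, Bool.false_eq_true]; ring1
      · simp only [signedSum, reduceIte, Bool.false_eq_true]; ring1
      · simp [*, Ne.symm]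
    | refine hA.not_mem_of_sum_eq_sum (x := (a, d, true)) (by assumption) (fun l ↦ ?_) (fun l ↦ ?_) ?_
      · simp only [signedSum, reduceIte, Bool.false_eq_true]; ring1
      · simp only [signedSum, reduceIte, Bool.false_eq_true]; ring1
      · simp [*, Ne.symm]
    | refine hA.not_mem_of_sum_eq_sum (x := (a, d, false)) (by assumption) (fun l ↦ ?_) (fun l ↦ ?_) ?_
      · simp only [signedSum, reduceIte, Bool.false_eq_true]; ring1
      · simp only [signedSum, reduceIte, Bool.false_eq_true]; ring1
      · simp [*, Ne.symm]

/-- Double counting: a root with both indices in `S` survives the deletion of every element of `S`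
but those two, so the bounds for the sets `S.erase k` average to the bound for `S`. -/
lemma card_filter_le (hA : IsSeparated A) (hlt : ∀ x ∈ A, x.1 < x.2.1) (m : ℕ)
    (S : Finset (Fin n)) (hS : S.card = m + 4) :
    (A.filter fun x ↦ x.1 ∈ S ∧ x.2.1 ∈ S).card ≤ (m + 4).choose 2 := by
  induction m generalizing S with
  | zero =>
    let f := S.orderEmbOfFin hS
    have hf : S = {f 0, f 1, f 2, f 3} := by
      have hu : (Finset.univ : Finset (Fin 4)) = {0, 1, 2, 3} := rfl
      rw [← S.image_orderEmbOfFin_univ hS]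
      erw [hu]
      simp [f]
    rw [hf]
    exact hA.card_filter_four_le hlt (f.strictMono (by decide)) (f.strictMono (by decide))
      (f.strictMono (by decide))
  | succ m ih =>
    set B := A.filter fun x ↦ x.1 ∈ S ∧ x.2.1 ∈ S with hB
    have h1 : ∑ k ∈ S, (A.filter fun x ↦ x.1 ∈ S.erase k ∧ x.2.1 ∈ S.erase k).card =
        ∑ x ∈ B, (m + 3) := by
      have h2 (k : Fin n) : (A.filter fun x ↦ x.1 ∈ S.erase k ∧ x.2.1 ∈ S.erase k) =
          Finset.bipartiteAbove (fun k x ↦ k ≠ x.1 ∧ k ≠ x.2.1) B k := by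
        ext x
        simp only [hB, Finset.bipartiteAbove, Finset.mem_filter, Finset.mem_erase, ne_eq,
          eq_comm (a := k)]
        tauto
      simp_rw [h2]
      rw [Finset.sum_card_bipartiteAbove_eq_sum_card_bipartiteBelow]
      refine Finset.sum_congr rfl fun x hx ↦ ?_
      obtain ⟨hxA, hx1, hx2⟩ := Finset.mem_filter.1 hx
      have h3 : Finset.bipartiteBelow (fun k (x : Fin n × Fin n × Bool) ↦ k ≠ x.1 ∧ k ≠ x.2.1) S x =
          (S.erase x.1).erase x.2.1 := by
        ext k
        simp only [Finset.bipartiteBelow, Finset.mem_filter, Finset.mem_erase]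
        tauto
      rw [h3, Finset.card_erase_of_mem, Finset.card_erase_of_mem hx1, hS]
      · rfl
      · exact Finset.mem_erase.2 ⟨(hlt x hxA).ne', hx2⟩
    have h4 : ∑ k ∈ S, (A.filter fun x ↦ x.1 ∈ S.erase k ∧ x.2.1 ∈ S.erase k).card ≤
        ∑ k ∈ S, (m + 4).choose 2 :=
      Finset.sum_le_sum fun k hk ↦ ih _ (by rw [Finset.card_erase_of_mem hk, hS]; rfl)
    rw [h1, Finset.sum_const, Finset.sum_const, hS, smul_eq_mul, smul_eq_mul] at h4
    have h7 : (m + 4).choose 2 * 2 = (m + 4) * (m + 3) := by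
      simp [← Nat.add_one_mul_choose_eq]
    have h8 : (m + 1 + 4).choose 2 * 2 = (m + 5) * (m + 4) := by
      simp [← Nat.add_one_mul_choose_eq]
    have h9 : 0 < 2 * (m + 3) := by positivity
    refine Nat.le_of_mul_le_mul_right ?_ h9
    nlinarith

lemma card_le (hA : IsSeparated A) (hlt : ∀ x ∈ A, x.1 < x.2.1) (hn : 4 ≤ n) :
    A.card ≤ n.choose 2 := by
  obtain ⟨m, rfl⟩ := Nat.exists_eq_add_of_le' hn
  simpa using hA.card_filter_le hlt m Finset.univ (by simp)

end IsSeparated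

/-! ### Standard coordinates and general facts on positive roots -/

namespace RootPairing.Base

/-- The simple roots of `b` are numbered as `α 0, …, α (n - 1)` and expressed by vectors
`v 0, …, v (n - 1)` as in the standard model of the root system of type `Dₙ`. -/
structure IsStandardFrame {ι M N : Type*} [AddCommGroup M] [Module ℝ M]
    [AddCommGroup N] [Module ℝ N] {P : RootPairing ι ℝ M N} (b : P.Base) {n : ℕ}
    (α : Fin n → ι) (v : Fin n → M) : Prop where
  mem_support : ∀ i, α i ∈ b.support
  exists_eq : ∀ r ∈ b.support, ∃ i, α i = r
  root_of_succ : ∀ i j : Fin n, i.val + 1 = j → P.root (α i) = v i - v j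
  root_last : ∀ i j : Fin n, i.val + 2 = n → j.val + 1 = n → P.root (α j) = v i + v j
  coroot'_of_succ : ∀ i j k : Fin n, i.val + 1 = j →
    P.coroot' (α i) (v k) = (if k = i then 1 else 0) - (if k = j then 1 else 0)
  coroot'_last : ∀ i j k : Fin n, i.val + 2 = n → j.val + 1 = n →
    P.coroot' (α j) (v k) = (if k = i then 1 else 0) + (if k = j then 1 else 0)

section

variable {ι M N : Type*} [AddCommGroup M] [Module ℝ M]
  [AddCommGroup N] [Module ℝ N] {P : RootPairing ι ℝ M N} {b : P.Base} {n : ℕ}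

lemma exists_map_root_eq_height (b : P.Base) [P.IsRootSystem] :
    ∃ f : M →ₗ[ℝ] ℝ, ∀ r, f (P.root r) = b.height r := by
  let f : M →ₗ[ℝ] ℝ := b.toWeightBasis.constr ℝ fun _ ↦ (1 : ℝ)
  have hf (r : ι) (hr : r ∈ b.support) : f (P.root r) = 1 := by
    have := b.toWeightBasis.constr_basis ℝ (fun _ ↦ (1 : ℝ)) ⟨r, hr⟩
    rwa [toWeightBasis_apply] at this
  refine ⟨f, fun r ↦ ?_⟩
  obtain ⟨g, -, -, hg⟩ := b.exists_root_eq_sum_int r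
  rw [b.height_eq_sum hg, hg, map_sum, Int.cast_sum]
  exact Finset.sum_congr rfl fun j hj ↦ by rw [map_zsmul, hf j hj]; simp

lemma exists_pos_on_positiveRoots (b : P.Base) [P.IsRootSystem] :
    ∃ f : M →ₗ[ℝ] ℝ, ∀ x ∈ b.positiveRoots, 0 < f x := by
  obtain ⟨f, hf⟩ := b.exists_map_root_eq_height
  refine ⟨f, ?_⟩
  rintro _ ⟨r, hr, rfl⟩
  rw [hf]
  exact Int.cast_pos.2 hr

lemma neg_notMem_positiveRoots (b : P.Base) [P.IsRootSystem] {x : M}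
    (hx : x ∈ b.positiveRoots) : -x ∉ b.positiveRoots := by
  obtain ⟨f, hf⟩ := b.exists_pos_on_positiveRoots
  intro hneg
  have h1 := hf x hx
  have h2 := hf _ hneg
  rw [map_neg] at h2
  linarith

lemma smul_mem_positiveRoots_or (b : P.Base) (w : P.weylGroup) {x : M}
    (hx : x ∈ b.positiveRoots) : w • x ∈ b.positiveRoots ∨ -(w • x) ∈ b.positiveRoots := by
  obtain ⟨r, -, rfl⟩ := hx
  rw [weylGroup_apply_root]
  let := P.indexNeg
  rcases IsPos.or_neg b (P.weylGroupToPerm w r) with h | h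
  · exact Or.inl ⟨_, h, rfl⟩
  · refine Or.inr ⟨_, h, ?_⟩
    rw [indexNeg_neg, root_reflectionPerm, reflection_apply_self]

lemma finite_weylGroup [Finite ι] [P.IsRootSystem] (b : P.Base) : Finite P.weylGroup := by
  refine Finite.of_injective P.weylGroupToPerm fun g g' hgg' ↦ Subtype.ext ?_
  apply Equiv.weightHom_injective P
  apply LinearEquiv.toLinearMap_injective
  refine b.toWeightBasis.ext fun i ↦ ?_
  rw [toWeightBasis_apply]
  change g • P.root i = g' • P.root i
  rw [weylGroup_apply_root, weylGroup_apply_root, hgg']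

/-- Removing `w` destroys completeness, and any root left uncovered is private to `w`. -/
lemma IsMinimalInversionComplete.exists_mem_inversionSet
    {Y : Set P.weylGroup} (hY : b.IsMinimalInversionComplete Y) {w : P.weylGroup} (hw : w ∈ Y) :
    ∃ x ∈ b.inversionSet w, ∀ u ∈ Y, x ∈ b.inversionSet u → u = w := by
  have h1 : ¬ b.IsInversionComplete (Y \ {w}) := fun h ↦
    (hY.le_of_le h Set.sdiff_subset hw).2 rfl
  have h2 : ¬ b.positiveRoots ⊆ ⋃ u ∈ Y \ {w}, b.inversionSet u := fun h ↦
    h1 (Set.Subset.antisymm (Set.iUnion₂_subset fun u _ x hx ↦ hx.1) h)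
  obtain ⟨x, hx, hxu⟩ := Set.not_subset.1 h2
  have h3 (u) (hu : u ∈ Y) (hxu' : x ∈ b.inversionSet u) : u = w := by
    by_contra hne
    exact hxu (Set.mem_biUnion (⟨hu, hne⟩ : u ∈ Y \ {w}) hxu')
  refine ⟨x, ?_, h3⟩
  rw [← show ⋃ u ∈ Y, b.inversionSet u = b.positiveRoots from hY.prop, Set.mem_iUnion₂] at hx
  obtain ⟨u, hu, hxu'⟩ := hx
  rwa [← h3 u hu hxu']

lemma IsTypeD.exists_isStandardFrame [P.IsRootSystem] [P.IsCrystallographic]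
    (hb : b.IsTypeD n) (hn : 4 ≤ n) :
    ∃ (α : Fin n → ι) (v : Fin n → M), b.IsStandardFrame α v := by
  obtain ⟨e, he⟩ := hb
  have hpair (i j : Fin n) :
      P.pairing (e.symm i) (e.symm j) = ((CartanMatrix.D n i j : ℤ) : ℝ) := by
    rw [← b.algebraMap_cartanMatrixIn_apply ℤ]
    have := he (e.symm i) (e.symm j)
    simp only [Equiv.apply_symm_apply] at this
    rw [← this]
    rfl
  -- The intended value of the `i`-th simple coroot on `v k`; prescribing these values determines `v
  -- k`, since the simple coroots form a basis.
  let C (k i : Fin n) : ℝ :=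
    if i.val + 1 < n then (if k = i then 1 else 0) - (if k.val = i.val + 1 then 1 else 0)
    else if k.val + 2 = n ∨ k.val + 1 = n then 1 else 0
  let v (k : Fin n) : M := P.toPerfPair.symm (b.toCoweightBasis.constr ℝ fun i ↦ C k (e i))
  have hv (k i : Fin n) : P.coroot' (e.symm i) (v k) = C k i := by
    change P.toPerfPair (v k) (P.coroot (e.symm i)) = _
    rw [LinearEquiv.apply_symm_apply, ← toCoweightBasis_apply, Module.Basis.constr_basis]
    simp
  have hext (x y : M) (h : ∀ i, P.coroot' (e.symm i) x = P.coroot' (e.symm i) y) : x = y := by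
    apply P.toPerfPair.injective
    apply b.toCoweightBasis.ext
    intro i
    have := h (e i)
    rw [e.symm_apply_apply] at this
    simpa using! this
  refine ⟨fun i ↦ e.symm i, v, fun i ↦ (e.symm i).2, fun r hr ↦ ⟨e ⟨r, hr⟩, by simp⟩, ?_, ?_, ?_, ?_⟩
  · intro i j hij
    refine hext _ _ fun k ↦ ?_
    rw [map_sub, hv, hv, root_coroot'_eq_pairing, hpair]
    simp only [CartanMatrix.D, Matrix.of_apply, C, Fin.ext_iff]
    split_ifs <;> first | omega | norm_num
  · intro i j hi hj
    refine hext _ _ fun k ↦ ?_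
    rw [map_add, hv, hv, root_coroot'_eq_pairing, hpair]
    simp only [CartanMatrix.D, Matrix.of_apply, C, Fin.ext_iff]
    split_ifs <;> first | omega | norm_num
  · intro i j k hij
    rw [hv]
    simp only [C, Fin.ext_iff]
    rw [if_pos (by omega), hij]
  · intro i j k hi hj
    rw [hv]
    simp only [C, Fin.ext_iff]
    rw [if_neg (by omega)]
    split_ifs <;> first | omega | norm_num

end

/-! ### Weyl group action and positive roots in coordinates -/

namespace IsStandardFrame

variable {ι M N : Type*} [AddCommGroup M] [Module ℝ M]
  [AddCommGroup N] [Module ℝ N] {P : RootPairing ι ℝ M N} {b : P.Base} {n : ℕ}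
  {α : Fin n → ι} {v : Fin n → M}

lemma reflection_of_succ (h : b.IsStandardFrame α v) {i j : Fin n} (hij : i.val + 1 = j)
    (k : Fin n) : P.reflection (α i) (v k) = v (Equiv.swap i j k) := by
  have hne : i ≠ j := by rintro rfl; omega
  rw [reflection_apply, h.coroot'_of_succ i j k hij, h.root_of_succ i j hij]
  rcases eq_or_ne k i with rfl | hki
  · simp [hne]
  rcases eq_or_ne k j with rfl | hkj
  · simp [hne.symm]
  · simp [hki, hkj, Equiv.swap_apply_of_ne_of_ne hki hkj]

lemma reflection_last (h : b.IsStandardFrame α v) {i j : Fin n} (hi : i.val + 2 = n)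
    (hj : j.val + 1 = n) (k : Fin n) :
    P.reflection (α j) (v k) =
      (if k = i ∨ k = j then (-1 : ℝ) else 1) • v (Equiv.swap i j k) := by
  have hne : i ≠ j := by rintro rfl; omega
  rw [reflection_apply, h.coroot'_last i j k hi hj, h.root_last i j hi hj]
  rcases eq_or_ne k i with rfl | hki
  · simp [hne]
  rcases eq_or_ne k j with rfl | hkj
  · simp [hne.symm]
  · simp [hki, hkj, Equiv.swap_apply_of_ne_of_ne hki hkj]

lemma exists_reflection_eq (h : b.IsStandardFrame α v) (hn : 4 ≤ n) (i : Fin n) :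
    ∃ (σ : Equiv.Perm (Fin n)) (c : Fin n → ℝ), (∀ k, c k = 1 ∨ c k = -1) ∧
      ∀ k, P.reflection (α i) (v k) = c k • v (σ k) := by
  by_cases hi : i.val + 1 < n
  · exact ⟨Equiv.swap i ⟨i + 1, hi⟩, fun _ ↦ 1, by simp,
      fun k ↦ by rw [one_smul]; exact h.reflection_of_succ rfl k⟩
  · refine ⟨Equiv.swap ⟨n - 2, by omega⟩ i, _, fun k ↦ ?_,
      h.reflection_last (by simp only; omega) (by omega)⟩
    split_ifs <;> simp

lemma exists_smul_eq_perm (h : b.IsStandardFrame α v) (σ : Equiv.Perm (Fin n)) :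
    ∃ w : P.weylGroup, ∀ k, w • v k = v (σ k) := by
  obtain _ | m := n
  · exact ⟨1, fun k ↦ k.elim0⟩
  have hσ : σ ∈ Submonoid.closure (Set.range fun i : Fin m ↦ Equiv.swap i.castSucc i.succ) := by
    rw [Equiv.Perm.mclosure_swap_castSucc_succ]
    trivial
  induction hσ using Submonoid.closure_induction with
  | mem σ hσ =>
    obtain ⟨i, rfl⟩ := hσ
    exact ⟨weylGroup.ofIdx P (α i.castSucc), fun k ↦ h.reflection_of_succ (by simp) k⟩
  | one => exact ⟨1, fun k ↦ by simp⟩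
  | mul σ τ _ _ hσ hτ =>
    obtain ⟨w, hw⟩ := hσ
    obtain ⟨u, hu⟩ := hτ
    exact ⟨w * u, fun k ↦ by rw [mul_smul, hu, hw]; rfl⟩

lemma map_eq_of_map_root_eq_height (h : b.IsStandardFrame α v) (hn : 4 ≤ n) {f : M →ₗ[ℝ] ℝ}
    (hf : ∀ r, f (P.root r) = b.height r) (k : Fin n) : f (v k) = n - 1 - k.val := by
  have hα (i : Fin n) : f (P.root (α i)) = 1 := by
    rw [hf, b.height_one_of_mem_support (h.mem_support i), Int.cast_one]
  have key (m : ℕ) (k : Fin n) (hk : k.val + 1 + m = n) : f (v k) = m := by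
    induction m generalizing k with
    | zero =>
      have h1 := hα ⟨n - 2, by omega⟩
      have h2 := hα k
      rw [h.root_last ⟨n - 2, by omega⟩ k (by simp only; omega) (by omega), map_add] at h2
      rw [h.root_of_succ _ k (by simp only; omega), map_sub] at h1
      simp only [Nat.cast_zero]
      linarith
    | succ m ih =>
      have h1 := hα k
      rw [h.root_of_succ k ⟨k + 1, by omega⟩ rfl, map_sub, ih ⟨k + 1, by omega⟩
        (by simp only; omega)] at h1
      push_cast
      linarith
  rw [key (n - 1 - k) k (by omega), Nat.cast_sub (by omega), Nat.cast_sub (by omega)]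
  simp

/-- Coordinate forms are built from coroots: half the difference of the last two gives the last
coordinate, and adding coroots one by one gives the earlier ones. -/
lemma exists_dual_eq (h : b.IsStandardFrame α v) (hn : 4 ≤ n) (i : Fin n) :
    ∃ g : M →ₗ[ℝ] ℝ, ∀ k, g (v k) = if k = i then 1 else 0 := by
  obtain ⟨m, hm⟩ : ∃ m, i.val + 1 + m = n := ⟨n - 1 - i, by omega⟩
  induction m generalizing i with
  | zero =>
    have hi : (⟨n - 2, by omega⟩ : Fin n).val + 1 = i := by simp only; omega
    refine ⟨(1 / 2 : ℝ) • (P.coroot' (α i) - P.coroot' (α ⟨n - 2, by omega⟩)), fun k ↦ ?_⟩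
    rw [LinearMap.smul_apply, LinearMap.sub_apply, h.coroot'_of_succ _ _ k hi,
      h.coroot'_last ⟨n - 2, by omega⟩ i k (by simp only; omega) (by omega)]
    split_ifs <;> norm_num
  | succ m ih =>
    obtain ⟨g, hg⟩ := ih ⟨i + 1, by omega⟩ (by simp only; omega)
    refine ⟨g + P.coroot' (α i), fun k ↦ ?_⟩
    rw [LinearMap.add_apply, hg, h.coroot'_of_succ i ⟨i + 1, by omega⟩ k rfl]
    ring

lemma eq_and_eq_of_add_eq_add (h : b.IsStandardFrame α v) (hn : 4 ≤ n) {i j k l : Fin n}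
    (hij : i < j) (hkl : k < l) (heq : v i + v j = v k + v l) : i = k ∧ j = l := by
  have key (m : Fin n) : ((if i = m then 1 else 0) + if j = m then 1 else 0 : ℝ) =
      (if k = m then 1 else 0) + if l = m then 1 else 0 := by
    obtain ⟨g, hg⟩ := h.exists_dual_eq hn m
    have := congrArg g heq
    simpa only [map_add, hg] using this
  have h1 := key i
  have h2 := key j
  simp only [hij.ne', hij.ne, if_true, if_false] at h1 h2
  have h3 : k = i ∨ l = i := by
    by_contra! hne
    simp [hne.1, hne.2] at h1
  have h4 : k = j ∨ l = j := by
    by_contra! hne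
    simp [hne.1, hne.2] at h2
  omega

/-- Simple roots have this shape, and simple reflections permute the `v k` up to sign. -/
lemma exists_root_eq [Finite ι] [P.IsRootSystem] [P.IsCrystallographic] [P.IsReduced]
    (h : b.IsStandardFrame α v) (hn : 4 ≤ n) (r : ι) :
    ∃ (i j : Fin n) (c d : ℝ), i ≠ j ∧ (c = 1 ∨ c = -1) ∧ (d = 1 ∨ d = -1) ∧
      P.root r = c • v i + d • v j := by
  induction r using b.induction_reflect with
  | h₀ r hr =>
    obtain ⟨i, j, c, d, hij, hc, hd, hr⟩ := hr
    refine ⟨i, j, -c, -d, hij, by grind, by grind, ?_⟩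
    rw [root_reflectionPerm, reflection_apply_self, hr]
    module
  | h₁ r hr =>
    obtain ⟨i, rfl⟩ := h.exists_eq r hr
    by_cases hi : i.val + 1 < n
    · refine ⟨i, ⟨i + 1, hi⟩, 1, -1, by simp [Fin.ext_iff], by simp, by simp, ?_⟩
      rw [h.root_of_succ i ⟨i + 1, hi⟩ rfl]
      module
    · refine ⟨⟨n - 2, by omega⟩, i, 1, 1, by simp only [ne_eq, Fin.ext_iff]; omega,
        by simp, by simp, ?_⟩
      rw [h.root_last ⟨n - 2, by omega⟩ i (by simp only; omega) (by omega)]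
      module
  | h₂ r s hr hs =>
    obtain ⟨i, j, c, d, hij, hc, hd, hr⟩ := hr
    obtain ⟨k, rfl⟩ := h.exists_eq s hs
    obtain ⟨σ, e, he, hσ⟩ := h.exists_reflection_eq hn k
    refine ⟨σ i, σ j, c * e i, d * e j, σ.injective.ne hij, ?_, ?_, ?_⟩
    · rcases hc with rfl | rfl <;> rcases he i with h | h <;> simp [h]
    · rcases hd with rfl | rfl <;> rcases he j with h | h <;> simp [h]
    · rw [root_reflectionPerm, hr, map_add, map_smul, map_smul, hσ, hσ, smul_smul, smul_smul]

/-- The positive roots are exactly the vectors `v i ± v j` with `i < j`. -/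
lemma mem_positiveRoots_iff [Finite ι] [P.IsRootSystem] [P.IsCrystallographic] [P.IsReduced]
    (h : b.IsStandardFrame α v) (hn : 4 ≤ n) (x : M) :
    x ∈ b.positiveRoots ↔ ∃ y : Fin n × Fin n × Bool, y.1 < y.2.1 ∧ signedSum v y = x := by
  obtain ⟨f, hf⟩ := b.exists_map_root_eq_height
  have hfv := h.map_eq_of_map_root_eq_height hn hf
  have hpos (r : ι) : b.IsPos r ↔ 0 < f (P.root r) := by
    rw [hf, Int.cast_pos]
    rfl
  have hlt (i : Fin n) : (0 : ℝ) ≤ n - 1 - i.val := by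
    have : ((i.val + 1 : ℕ) : ℝ) ≤ n := Nat.cast_le.2 i.2
    push_cast at this
    linarith
  constructor
  · rintro ⟨r, hr, rfl⟩
    obtain ⟨i, j, c, d, hij, hc, hd, heq⟩ := h.exists_root_eq hn r
    rw [hpos, heq, map_add, map_smul, map_smul, hfv, hfv, smul_eq_mul, smul_eq_mul] at hr
    have hi := hlt i
    have hj := hlt j
    rcases hc with rfl | rfl <;> rcases hd with rfl | rfl
    · rcases lt_or_gt_of_ne hij with hij | hij
      · exact ⟨(i, j, true), hij, by simp [signedSum, heq]⟩
      · exact ⟨(j, i, true), hij, by simp [signedSum, heq, add_comm]⟩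
    · have : (i.val : ℝ) < j.val := by linarith
      exact ⟨(i, j, false), Fin.lt_def.2 (Nat.cast_lt.1 this), by simp [signedSum, heq, sub_eq_add_neg]⟩
    · have : (j.val : ℝ) < i.val := by linarith
      exact ⟨(j, i, false), Fin.lt_def.2 (Nat.cast_lt.1 this), by
        simp [signedSum, heq, sub_eq_add_neg, add_comm]⟩
    · linarith
  · rintro ⟨⟨i, j, s⟩, hij, rfl⟩
    have hij' : (i.val : ℝ) < j.val := Nat.cast_lt.2 (Fin.lt_def.1 hij)
    have hi := hlt i
    have hj := hlt j
    obtain ⟨p, q, hp, hq⟩ : ∃ p q : Fin n, p.val + 2 = n ∧ q.val + 1 = n :=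
      ⟨⟨n - 2, by omega⟩, ⟨n - 1, by omega⟩, by simp only; omega, by simp only; omega⟩
    have hpq : p ≠ q := by rintro rfl; omega
    obtain ⟨σ, hσp, hσq⟩ := exists_perm_apply_eq_and_apply_eq hpq (ne_of_lt hij)
    obtain ⟨w, hw⟩ := h.exists_smul_eq_perm σ
    cases s
    · have hr : P.root (P.weylGroupToPerm w (α p)) = signedSum v (i, j, false) := by
        rw [← weylGroup_apply_root, h.root_of_succ p q (by omega), smul_sub, hw, hw, hσp, hσq]
        simp [signedSum]
      refine ⟨_, ?_, hr⟩
      rw [hpos, hr]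
      simp only [signedSum, Bool.false_eq_true, if_false, map_sub, hfv]
      linarith
    · have hr : P.root (P.weylGroupToPerm w (α q)) = signedSum v (i, j, true) := by
        rw [← weylGroup_apply_root, h.root_last p q hp hq, smul_add, hw, hw, hσp, hσq]
        simp [signedSum]
      refine ⟨_, ?_, hr⟩
      rw [hpos, hr]
      simp only [signedSum, if_true, map_add, hfv]
      linarith

end IsStandardFrame

end RootPairing.Base

/-! ### The two bounds -/

namespace RootPairing.Base

namespace IsStandardFrame

variable {ι M N : Type*} [Finite ι] [AddCommGroup M] [Module ℝ M]
  [AddCommGroup N] [Module ℝ N] {P : RootPairing ι ℝ M N} [P.IsRootSystem]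
  [P.IsCrystallographic] [P.IsReduced] {b : P.Base} {n : ℕ}
  {α : Fin n → ι} {v : Fin n → M}

lemma encard_le (h : b.IsStandardFrame α v) (hn : 4 ≤ n) {Y : Set P.weylGroup}
    (hY : b.IsMinimalInversionComplete Y) : Y.encard ≤ n.choose 2 := by
  classical
  obtain ⟨f, hf⟩ := b.exists_pos_on_positiveRoots
  have hex (w : Y) : ∃ x : Fin n × Fin n × Bool, x.1 < x.2.1 ∧
      signedSum v x ∈ b.inversionSet w.1 ∧ ∀ u ∈ Y, signedSum v x ∈ b.inversionSet u → u = w := by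
    obtain ⟨x, hx, hu⟩ := hY.exists_mem_inversionSet w.2
    obtain ⟨y, hy, rfl⟩ := (h.mem_positiveRoots_iff hn x).1 hx.1
    exact ⟨y, hy, hx, hu⟩
  choose y hy hyw hyu using hex
  have hinj : Function.Injective y := fun w u hwu ↦
    Subtype.ext (hyu u w.1 w.2 (by rw [← hwu]; exact hyw w))
  have := Finite.of_injective y hinj
  have := Fintype.ofFinite Y
  have hsep : IsSeparated (Finset.univ.image y) := by
    intro x hx
    have hpos := (h.mem_positiveRoots_iff hn _).2 ⟨x, hx, rfl⟩
    have hmem := hpos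
    rw [← show ⋃ u ∈ Y, b.inversionSet u = b.positiveRoots from hY.prop, Set.mem_iUnion₂] at hmem
    obtain ⟨w, hw, hxw⟩ := hmem
    refine ⟨fun k ↦ f (w⁻¹ • v k), y ⟨w, hw⟩, ?_, fun z hz hzw ↦ ?_⟩
    · rw [← map_signedSum, ← smul_signedSum]
      have := hf _ hxw.2
      rw [map_neg] at this
      linarith
    · obtain ⟨u, -, rfl⟩ := Finset.mem_image.1 hz
      rw [← map_signedSum, ← smul_signedSum]
      refine hf _ ((b.smul_mem_positiveRoots_or w⁻¹ (hyw u).1).resolve_right fun hneg ↦ hzw ?_)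
      have := hyu u w hw ⟨(hyw u).1, hneg⟩
      congr
      exact Subtype.ext this.symm
  have hcard := hsep.card_le (Finset.forall_mem_image.2 fun w _ ↦ hy w) hn
  rw [Finset.card_image_of_injective _ hinj, Finset.card_univ, ← Nat.card_eq_fintype_card,
    Nat.card_coe_set_eq] at hcard
  rw [← (Set.toFinite Y).cast_ncard_eq]
  exact_mod_cast hcard

/-- The Weyl group elements with at most one inversion of the form `v i + v j`. -/
def fewInversions (b : P.Base) (v : Fin n → M) : Set P.weylGroup :=
  {w | ∀ i j k l : Fin n, i < j → k < l → v i + v j ∈ b.inversionSet w →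
    v k + v l ∈ b.inversionSet w → v i + v j = v k + v l}

lemma add_mem_positiveRoots (h : b.IsStandardFrame α v) (hn : 4 ≤ n) {i j : Fin n} (hij : i ≠ j) :
    v i + v j ∈ b.positiveRoots := by
  rcases lt_or_gt_of_ne hij with hij | hij
  · exact (h.mem_positiveRoots_iff hn _).2 ⟨(i, j, true), hij, rfl⟩
  · exact (h.mem_positiveRoots_iff hn _).2 ⟨(j, i, true), hij, by simp [signedSum, add_comm]⟩

lemma isInversionComplete_fewInversions (h : b.IsStandardFrame α v) (hn : 4 ≤ n) :
    b.IsInversionComplete (fewInversions b v) := by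
  refine Set.Subset.antisymm (Set.iUnion₂_subset fun u _ x hx ↦ hx.1) fun x hx ↦ ?_
  rw [Set.mem_iUnion₂]
  obtain ⟨⟨i, j, s⟩, hij, rfl⟩ := (h.mem_positiveRoots_iff hn x).1 hx
  cases s
  -- A permutation of the `v k` inverts no sum; this transposition negates `v i - v j`.
  · obtain ⟨w, hw⟩ := h.exists_smul_eq_perm (Equiv.swap i j)
    refine ⟨w⁻¹, fun k l _ _ hkl _ hmem _ ↦ ?_, hx, ?_⟩
    · have h1 := hmem.2
      rw [inv_inv, smul_add, hw, hw] at h1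
      exact absurd h1 (b.neg_notMem_positiveRoots
        (h.add_mem_positiveRoots hn ((Equiv.swap i j).injective.ne hkl.ne)))
    · simpa [signedSum, smul_sub, hw] using hx
  · obtain ⟨p, q, hp, hq⟩ : ∃ p q : Fin n, p.val + 2 = n ∧ q.val + 1 = n :=
      ⟨⟨n - 2, by omega⟩, ⟨n - 1, by omega⟩, by simp only; omega, by simp only; omega⟩
    have hpq : p ≠ q := by rintro rfl; omega
    obtain ⟨σ, hσi, hσj⟩ := exists_perm_apply_eq_and_apply_eq (ne_of_lt hij) hpq
    obtain ⟨w, hw⟩ := h.exists_smul_eq_perm σ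
    -- `w` carries `v i + v j` to the simple root `α q`. Its reflection keeps every other positive
    -- root positive, so `v i + v j` is the only sum that `u` makes negative.
    let u := weylGroup.ofIdx P (α q) * w
    have hu (x : M) : u • x = P.reflection (α q) (w • x) := mul_smul _ _ _
    have hroot := h.root_last p q hp hq
    have key {k l : Fin n} (hkl : k < l) (hmem : v k + v l ∈ b.inversionSet u⁻¹) :
        v k + v l = v i + v j := by
      have h1 := hmem.2
      rw [inv_inv, hu, smul_add, hw, hw] at h1
      obtain ⟨r, hr, hrkl⟩ := h.add_mem_positiveRoots hn (σ.injective.ne hkl.ne)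
      by_cases hrq : r = α q
      · apply (MulAction.injective w)
        simp only [smul_add, hw, hσi, hσj, ← hroot, ← hrkl, hrq]
      · have h2 := hr.reflectionPerm (h.mem_support q) hrq
        rw [← hrkl, ← root_reflectionPerm] at h1
        exact absurd h1 (b.neg_notMem_positiveRoots ⟨_, h2, rfl⟩)
    refine ⟨u⁻¹, fun k l k' l' hkl hkl' hm hm' ↦ (key hkl hm).trans (key hkl' hm').symm, hx, ?_⟩
    rw [inv_inv, hu]
    simp only [signedSum, if_true, smul_add, hw, hσi, hσj, ← hroot]
    rw [reflection_apply_self, neg_neg]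
    exact ⟨_, b.isPos_of_mem_support (h.mem_support q), rfl⟩

lemma le_encard (h : b.IsStandardFrame α v) (hn : 4 ≤ n) {Y : Set P.weylGroup}
    (hY : b.IsInversionComplete Y) (hYv : Y ⊆ fewInversions b v) : n.choose 2 ≤ Y.encard := by
  classical
  have hex (s : Finset.powersetCard 2 (Finset.univ : Finset (Fin n))) :
      ∃ w : Y, ∃ i j : Fin n, i < j ∧ s.1 = {i, j} ∧ v i + v j ∈ b.inversionSet w.1 := by
    obtain ⟨i, j, hij, hs⟩ : ∃ i j : Fin n, i < j ∧ s.1 = {i, j} := by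
      obtain ⟨i, j, hij, hs⟩ := Finset.card_eq_two.1 (Finset.mem_powersetCard.1 s.2).2
      rcases lt_or_gt_of_ne hij with hij | hij
      · exact ⟨i, j, hij, hs⟩
      · exact ⟨j, i, hij, by rw [hs, Finset.pair_comm]⟩
    have hmem := h.add_mem_positiveRoots hn hij.ne
    rw [← show ⋃ u ∈ Y, b.inversionSet u = b.positiveRoots from hY, Set.mem_iUnion₂] at hmem
    obtain ⟨w, hw, hmem⟩ := hmem
    exact ⟨⟨w, hw⟩, i, j, hij, hs, hmem⟩
  choose w i j hij hs hmem using hex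
  have hinj : Function.Injective w := by
    intro s t hst
    have h1 := hYv (w t).2 _ _ _ _ (hij s) (hij t) (by rw [← hst]; exact hmem s) (hmem t)
    obtain ⟨h2, h3⟩ := h.eq_and_eq_of_add_eq_add hn (hij s) (hij t) h1
    exact Subtype.ext (by rw [hs, hs t, h2, h3])
  have hcard := ENat.card_le_card_of_injective hinj
  simpa using hcard

end IsStandardFrame

end RootPairing.Base

/-- For `n ≥ 4`, the maximal cardinality of a minimal inversion complete subset of the Weyl group
of a root system of type `Dₙ` is `n.choose 2`. -/
theorem mainTheorem3 {ι M N : Type*} [Finite ι] [AddCommGroup M] [Module ℝ M]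
    [AddCommGroup N] [Module ℝ N] (P : RootPairing ι ℝ M N) [P.IsRootSystem]
    [P.IsCrystallographic] [P.IsReduced] (b : P.Base) (n : ℕ) (hn : 4 ≤ n) (hb : b.IsTypeD n) :
    IsGreatest {k : ℕ∞ | ∃ Y : Set P.weylGroup, b.IsMinimalInversionComplete Y ∧ Y.encard = k}
      (n.choose 2 : ℕ∞) := by
  have := b.finite_weylGroup
  obtain ⟨α, v, h⟩ := hb.exists_isStandardFrame hn
  refine ⟨?_, ?_⟩
  · obtain ⟨Y, hYv, hY⟩ := exists_minimal_le_of_wellFoundedLT b.IsInversionComplete _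
      (h.isInversionComplete_fewInversions hn)
    exact ⟨Y, hY, le_antisymm (h.encard_le hn hY) (h.le_encard hn hY.prop hYv)⟩
  · rintro k ⟨Y, hY, rfl⟩
    exact h.encard_le hn hY
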